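/- Let $p$ be a prime and let $G$ be a totally disconnected locally compact Hausdorff (t.d.l.c.) group. Let $C_b(G,\mathbb{Q}_p)$ be the space of bounded continuous functions $G\to\mathbb{Q}_p$ with the supremum norm, with the left action $(g\cdot f)(x)=f(g^{-1}x)$. A left-invariant normed $\mathbb{Q}_p$-mean on $G$ is a bounded linear map $m:C_b(G,\mathbb{Q}_p)\to\mathbb{Q}_p$ with $m(\mathbf{1}_G)=1$ and $m(g\cdot f)=m(f)$ for all $g\in G$ and $f\in C_b(G,\mathbb{Q}_p)$. The group $G$ is called normed $p$-adic amenable if such an $m$ exists, and $\|G\|_p\in[0,\infty]$ denotes the infimum of the operator norms of all such $m$ (equal to $\infty$ if there are none). The group $G$ is called locally elliptic if it is a directed union of compact open subgroups. For a natural number $n$, $G$ is called $n$-free if for all open subgroups $V\le U\le G$ of finite index $[U:V]$, the index $[U:V]$ is not divisible by $n$; and $G$ is called $p^{\mathbb{N}}$-free if it is $p^k$-free for some integer $k\ge 1$. Then $G$ is normed $p$-adic amenable if and only if it is locally elliptic and $p^{\mathbb{N}}$-free. In this case $$\|G\|_p=\min\{p^k : k\ge 0,\ G\text{ is }p^{k+1}\text{-free}\}=\max\{p^k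 : k\ge 0,\ \text{there exist open subgroups } V\le U\le G \text{ with } [U:V]<\infty \text{ and } p^k\mid[U:V]\}.$$ -/

import Mathlib

open scoped BoundedContinuousFunction ENNReal

noncomputable section

/-- The left translate `g · f` of a bounded continuous function: `(g · f) x = f (g⁻¹ x)`. -/
def leftTranslate {G : Type*} [Group G] [TopologicalSpace G] [IsTopologicalGroup G]
    {p : ℕ} [Fact p.Prime] (g : G) (f : G →ᵇ ℚ_[p]) : G →ᵇ ℚ_[p] :=
  f.compContinuous (ContinuousMap.mulLeft g⁻¹)

/-- A left-invariant normed `p`-adic mean on `G`: a bounded linear functional `m` on the space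
`G →ᵇ ℚ_[p]` of bounded continuous functions (with the supremum norm) with `m 1 = 1` and
`m (g · f) = m f`. -/
structure IsLeftInvariantPadicMean {G : Type*} [Group G] [TopologicalSpace G]
    [IsTopologicalGroup G] {p : ℕ} [Fact p.Prime] (m : (G →ᵇ ℚ_[p]) →L[ℚ_[p]] ℚ_[p]) : Prop where
  map_one : m 1 = 1
  map_leftTranslate : ∀ (g : G) (f : G →ᵇ ℚ_[p]), m (leftTranslate g f) = m f

/-- `G` is normed `p`-adic amenable: it has a left-invariant normed `p`-adic mean. -/
def IsNormedPadicAmenable (p : ℕ) [Fact p.Prime] (G : Type*) [Group G] [TopologicalSpace G]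
    [IsTopologicalGroup G] : Prop :=
  ∃ m : (G →ᵇ ℚ_[p]) →L[ℚ_[p]] ℚ_[p], IsLeftInvariantPadicMean m

/-- `‖G‖_p`: the infimum of the operator norms of the left-invariant normed `p`-adic means
on `G`, which is `∞` when there are none. -/
def padicAmenabilityNorm (p : ℕ) [Fact p.Prime] (G : Type*) [Group G] [TopologicalSpace G]
    [IsTopologicalGroup G] : ℝ≥0∞ :=
  ⨅ (m : (G →ᵇ ℚ_[p]) →L[ℚ_[p]] ℚ_[p]) (_ : IsLeftInvariantPadicMean m), (‖m‖₊ : ℝ≥0∞)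

/-- `G` is locally elliptic: it is a directed union of compact open subgroups. -/
def IsLocallyElliptic (G : Type*) [Group G] [TopologicalSpace G] : Prop :=
  ∃ S : Set (Subgroup G), DirectedOn (· ≤ ·) S ∧
    (∀ U ∈ S, IsCompact (U : Set G) ∧ IsOpen (U : Set G)) ∧
    (⋃ U ∈ S, (U : Set G)) = Set.univ

/-- `G` is `n`-free: for open subgroups `V ≤ U`, the index `[U : V]`, whenever finite, is not
divisible by `n`. (`V.relIndex U` is `[U : V]`, with the value `0` exactly when the index
is infinite.) -/
def IsNFree (n : ℕ) (G : Type*) [Group G] [TopologicalSpace G] : Prop :=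
  ∀ U V : Subgroup G, IsOpen (U : Set G) → IsOpen (V : Set G) → V ≤ U →
    V.relIndex U ≠ 0 → ¬ n ∣ V.relIndex U

/-- `G` is `n^ℕ`-free: it is `n ^ k`-free for some `k ≥ 1`. -/
def IsPowFree (n : ℕ) (G : Type*) [Group G] [TopologicalSpace G] : Prop :=
  ∃ k : ℕ, 1 ≤ k ∧ IsNFree (n ^ k) G

end

/-! ### Compact open subgroups, p-adic norms of indices, weak-* limits -/

open Filter Topology

/-! Existence: averaging over `K ⧸ V`, with `K` compact open and `V ≤ K` open, costs norm `‖[K :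
V]⁻¹‖`, at most `p ^ k` when `G` is `p ^ (k + 1)`-free. As `ℚ_[p]` is proper, norm balls of
functionals are weak-* compact, so the averages have a limit point as `V` shrinks
(`exists_mean_of_isCompact`) and then as `K` grows (`exists_mean_of_isLocallyElliptic`).

Local ellipticity: if a finitely generated `Γ` had only infinite orbits on `G ⧸ K`, then `1` would
be a sum of bounded coboundaries (`exists_sum_coboundary_eq_one`), which a mean kills. A finite
orbit makes `Γ` relatively compact, and a compact set together with `K` generates a subgroup inside
`Γ * K`.

Norm: the `[U : V]` coset indicators, pulled back to `G`, are translates of each other with sum `1`,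
so each has mean `[U : V]⁻¹` (`IsLeftInvariantPadicMean.pow_le_norm`). The least `k` with `G` `p ^
(k + 1)`-free makes the two bounds meet. -/

/-- Van Dantzig's theorem. -/
theorem exists_isCompact_isOpen_subgroup_subset {G : Type*} [Group G] [TopologicalSpace G]
    [IsTopologicalGroup G] [T2Space G] [LocallyCompactSpace G] [TotallyDisconnectedSpace G]
    {O : Set G} (hO : O ∈ 𝓝 (1 : G)) :
    ∃ K : Subgroup G, IsCompact (K : Set G) ∧ IsOpen (K : Set G) ∧ (K : Set G) ⊆ O := by
  obtain ⟨C, hC1, hCO, hC⟩ := LocallyCompactSpace.local_compact_nhds (1 : G) O hO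
  obtain ⟨W, hW, hW1, hWC⟩ :=
    (loc_compact_Haus_tot_disc_of_zero_dim (H := G)).mem_nhds_iff.1 hC1
  have hWclopen : IsClopen W := hW
  have hWc : IsCompact W := hC.of_isClosed_subset hWclopen.1 hWC
  -- The right stabiliser of the compact open set `W`; the tube lemma below makes it a neighbourhood
  -- of `1`.
  let K : Subgroup G :=
    { carrier := {h | ∀ w ∈ W, w * h ∈ W ∧ w * h⁻¹ ∈ W}
      one_mem' := fun w hw => by simpa using hw
      mul_mem' := fun {a b} ha hb w hw => by
        constructor
        · rw [← mul_assoc]; exact (hb _ (ha w hw).1).1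
        · rw [mul_inv_rev, ← mul_assoc]; exact (ha _ (hb w hw).2).2
      inv_mem' := fun {a} ha w hw => by simpa using (ha w hw).symm }
  have hKW : (K : Set G) ⊆ W := fun h hh => by simpa using (hh 1 hW1).1
  obtain ⟨u, v, -, hv, hWu, h1v, huv⟩ := generalized_tube_lemma hWc (isCompact_singleton (x := (1 : G)))
    (n := {q : G × G | q.1 * q.2 ∈ W ∧ q.1 * q.2⁻¹ ∈ W})
    ((hWclopen.2.preimage (f := fun q : G × G => q.1 * q.2) (by fun_prop)).inter
      (hWclopen.2.preimage (f := fun q : G × G => q.1 * q.2⁻¹) (by fun_prop)))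
    (by rintro ⟨a, b⟩ ⟨ha, hb⟩
        obtain rfl : b = 1 := hb
        simpa using ha)
  have hKo : IsOpen (K : Set G) := by
    refine K.isOpen_of_mem_nhds (g := 1) (Filter.mem_of_superset
      (hv.mem_nhds (h1v rfl)) fun x hx w hw => huv (Set.mk_mem_prod (hWu hw) hx))
  exact ⟨K, hWc.of_isClosed_subset (K.isClosed_of_isOpen hKo) hKW, hKo, hKW.trans (hWC.trans hCO)⟩

theorem relIndex_ne_zero_of_isCompact {G : Type*} [Group G] [TopologicalSpace G]
    [IsTopologicalGroup G] {K V : Subgroup G} (hK : IsCompact (K : Set G))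
    (hV : IsOpen (V : Set G)) : V.relIndex K ≠ 0 := by
  have : CompactSpace K := isCompact_iff_compactSpace.1 hK
  have ho : IsOpen ((V.subgroupOf K : Subgroup K) : Set K) := hV.preimage continuous_subtype_val
  have : Finite (K ⧸ V.subgroupOf K) := Subgroup.quotient_finite_of_isOpen _ ho
  exact Subgroup.index_ne_zero_of_finite

theorem padic_norm_inv_natCast_le {p : ℕ} [Fact p.Prime] {n k : ℕ} (hn : ¬ p ^ (k + 1) ∣ n) :
    ‖(n : ℚ_[p])⁻¹‖ ≤ (p : ℝ) ^ k := by
  have hp : (0 : ℝ) < p := by exact_mod_cast (Fact.out : p.Prime).pos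
  have h1 : ¬ ‖((n : ℤ) : ℚ_[p])‖ ≤ (p : ℝ) ^ (-((k + 1 : ℕ) : ℤ)) := by
    rw [Padic.norm_int_le_pow_iff_dvd]
    exact_mod_cast hn
  -- Norms are powers of `p`, so exceeding `p ^ (-(k + 1))` means being at least `p ^ (-k)`.
  rw [Padic.norm_le_pow_iff_norm_lt_pow_add_one, not_lt] at h1
  have h2 : (-((k + 1 : ℕ) : ℤ) + 1) = -(k : ℤ) := by push_cast; ring
  rw [h2, zpow_neg, zpow_natCast, Int.cast_natCast] at h1
  rw [norm_inv]
  exact inv_le_of_inv_le₀ (by positivity) h1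

theorem le_padic_norm_inv_natCast {p : ℕ} [Fact p.Prime] {n k : ℕ} (h0 : n ≠ 0) (hn : p ^ k ∣ n) :
    (p : ℝ) ^ k ≤ ‖(n : ℚ_[p])⁻¹‖ := by
  have h1 : ‖((n : ℤ) : ℚ_[p])‖ ≤ (p : ℝ) ^ (-(k : ℤ)) := by
    rw [Padic.norm_int_le_pow_iff_dvd]
    exact_mod_cast hn
  rw [zpow_neg, zpow_natCast, Int.cast_natCast] at h1
  rw [norm_inv]
  exact le_inv_of_le_inv₀ (norm_pos_iff.2 (by exact_mod_cast h0)) h1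

/-- A uniformly bounded net of functionals has a limit point in the weak-* topology. -/
theorem exists_continuousLinearMap_of_tendsto {𝕜 E ι : Type*} [NontriviallyNormedField 𝕜]
    [ProperSpace 𝕜] [SeminormedAddCommGroup E] [NormedSpace 𝕜 E] (l : Filter ι) [l.NeBot]
    (M : ι → E →L[𝕜] 𝕜) {C : ℝ} (hM : ∀ i, ‖M i‖ ≤ C) :
    ∃ L : E →L[𝕜] 𝕜, ‖L‖ ≤ C ∧ ∀ f a, Tendsto (fun i => M i f) l (𝓝 a) → L f = a := by
  have hc := WeakDual.isCompact_closedBall (𝕜 := 𝕜) (E := E) 0 C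
  let U : Ultrafilter ι := Ultrafilter.of l
  obtain ⟨L, hL, hUL⟩ := hc.ultrafilter_le_nhds (U.map fun i => StrongDual.toWeakDual (M i))
    (le_principal_iff.2 (Filter.mem_map.2 (Filter.Eventually.of_forall fun i => by simpa using hM i)))
  refine ⟨WeakDual.toStrongDual L, by simpa using hL, fun f a hf => ?_⟩
  have h1 : Tendsto (fun i => M i f) U (𝓝 (L f)) :=
    ((WeakDual.eval_continuous f).tendsto L).comp hUL
  exact tendsto_nhds_unique h1 (hf.mono_left (Ultrafilter.of_le l))

/-! ### Construction of means -/

section Average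

variable {G : Type*} [Group G] [TopologicalSpace G] [IsTopologicalGroup G] {p : ℕ} [Fact p.Prime]

@[simp]
theorem leftTranslate_apply (g : G) (f : G →ᵇ ℚ_[p]) (x : G) :
    leftTranslate g f x = f (g⁻¹ * x) := rfl

/-- Averaging over the left cosets of a finite index subgroup `V` of `K` is almost invariant on
functions that are almost right `V`-invariant. -/
theorem exists_coset_average {K V : Subgroup G} (hKV : V.relIndex K ≠ 0) {C : ℝ}
    (hC : ‖(V.relIndex K : ℚ_[p])⁻¹‖ ≤ C) :
    ∃ M : (G →ᵇ ℚ_[p]) →L[ℚ_[p]] ℚ_[p], ‖M‖ ≤ C ∧ M 1 = 1 ∧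
      ∀ (f : G →ᵇ ℚ_[p]) (ε : ℝ), 0 ≤ ε → (∀ x ∈ K, ∀ v ∈ V, ‖f (x * v) - f x‖ ≤ ε) →
        ∀ g ∈ K, ‖M (leftTranslate g f) - M f‖ ≤ C * ε := by
  have hC0 : 0 ≤ C := (norm_nonneg _).trans hC
  have : Finite (K ⧸ V.subgroupOf K) := Nat.finite_of_card_ne_zero hKV
  have := Fintype.ofFinite (K ⧸ V.subgroupOf K)
  let φ : (G →ᵇ ℚ_[p]) →ₗ[ℚ_[p]] ℚ_[p] :=
    { toFun := fun f => (V.relIndex K : ℚ_[p])⁻¹ * ∑ q : K ⧸ V.subgroupOf K, f (q.out : K)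
      map_add' := fun f f' => by simp [Finset.sum_add_distrib, mul_add]
      map_smul' := fun c f => by simp [← Finset.mul_sum, mul_left_comm] }
  have hφ : ∀ f : G →ᵇ ℚ_[p], φ f =
    (V.relIndex K : ℚ_[p])⁻¹ * ∑ q : K ⧸ V.subgroupOf K, f (q.out : K) := fun _ => rfl
  have hb : ∀ f, ‖φ f‖ ≤ C * ‖f‖ := fun f => by
    rw [hφ, norm_mul]
    refine mul_le_mul hC ?_ (norm_nonneg _) hC0
    -- The ultrametric inequality spares a factor equal to the number of cosets.
    exact IsUltrametricDist.norm_sum_le_of_forall_le_of_nonneg (norm_nonneg _)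
      fun q _ => f.norm_coe_le_norm _
  refine ⟨φ.mkContinuous C hb, φ.mkContinuous_norm_le hC0 hb, ?_, fun f ε hε hf g hg => ?_⟩
  · have hcard : Fintype.card (K ⧸ V.subgroupOf K) = V.relIndex K := by
      rw [Fintype.card_eq_nat_card]; rfl
    simp only [LinearMap.mkContinuous_apply, hφ, BoundedContinuousFunction.coe_one, Pi.one_apply,
      Finset.sum_const, Finset.card_univ, hcard, nsmul_eq_mul, mul_one]
    exact inv_mul_cancel₀ (by exact_mod_cast hKV)
  · simp only [LinearMap.mkContinuous_apply, hφ]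
    let k : K := ⟨g, hg⟩
    rw [← mul_sub, norm_mul,
      ← Equiv.sum_comp (MulAction.toPerm k⁻¹ : Equiv.Perm (K ⧸ V.subgroupOf K))
        (fun q : K ⧸ V.subgroupOf K => f (q.out : K)), ← Finset.sum_sub_distrib]
    refine mul_le_mul hC ?_ (norm_nonneg _) hC0
    refine IsUltrametricDist.norm_sum_le_of_forall_le_of_nonneg hε fun q _ => ?_
    -- Translation permutes the cosets, but moves the chosen representatives by right factors from
    -- `V`.
    have h1 : (QuotientGroup.mk (k⁻¹ * q.out) : K ⧸ V.subgroupOf K) =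
        QuotientGroup.mk ((k⁻¹ • q).out) := by
      rw [QuotientGroup.out_eq', ← smul_eq_mul, MulAction.Quotient.mk_smul_out]
    rw [QuotientGroup.eq, Subgroup.mem_subgroupOf] at h1
    have h2 := hf _ (k⁻¹ * q.out : K).2 _ h1
    rw [norm_sub_rev, ← Subgroup.coe_mul, mul_inv_cancel_left] at h2
    exact h2

/-- On the compact `K`, a continuous `f` is uniformly almost right `V`-invariant for small `V`, so
the defect of invariance of the averages tends to `0` along `atBot`. -/
theorem exists_mean_of_isCompact [T2Space G] [LocallyCompactSpace G]
    [TotallyDisconnectedSpace G] {K : Subgroup G} (hK : IsCompact (K : Set G))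
    (hKo : IsOpen (K : Set G)) {C : ℝ}
    (hC : ∀ V : Subgroup G, IsOpen (V : Set G) → V ≤ K → ‖(V.relIndex K : ℚ_[p])⁻¹‖ ≤ C) :
    ∃ M : (G →ᵇ ℚ_[p]) →L[ℚ_[p]] ℚ_[p], ‖M‖ ≤ C ∧ M 1 = 1 ∧
      ∀ g ∈ K, ∀ f, M (leftTranslate g f) = M f := by
  have key : ∀ V : OpenSubgroup G, ∃ M : (G →ᵇ ℚ_[p]) →L[ℚ_[p]] ℚ_[p], ‖M‖ ≤ C ∧ M 1 = 1 ∧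
      ∀ (f : G →ᵇ ℚ_[p]) (ε : ℝ), 0 ≤ ε → (∀ x ∈ K, ∀ v ∈ V, ‖f (x * v) - f x‖ ≤ ε) →
        ∀ g ∈ K, ‖M (leftTranslate g f) - M f‖ ≤ C * ε := fun V => by
    -- Intersecting with `K` lets the net run over all open subgroups of `G`.
    have ho : IsOpen ((V.toSubgroup ⊓ K : Subgroup G) : Set G) := V.isOpen'.inter hKo
    obtain ⟨M, h1, h2, h3⟩ := exists_coset_average (relIndex_ne_zero_of_isCompact hK ho)
      (hC _ ho inf_le_right)
    exact ⟨M, h1, h2, fun f ε hε hf => h3 f ε hε fun x hx v hv => hf x hx v hv.1⟩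
  choose M hM1 hM2 hM3 using key
  have hC0 : 0 ≤ C := (norm_nonneg _).trans (hM1 ⊤)
  obtain ⟨L, hL, hlim⟩ := exists_continuousLinearMap_of_tendsto (atBot : Filter (OpenSubgroup G)) M hM1
  refine ⟨L, hL, hlim _ _ (by simp [hM2]), fun g hg f => ?_⟩
  rw [← sub_eq_zero, ← map_sub]
  refine hlim _ _ (Metric.tendsto_nhds.2 fun ε hε => ?_)
  obtain ⟨δ, hδ, hδε⟩ : ∃ δ > 0, C * δ < ε :=
    ⟨ε / (C + 1), by positivity, by
      rw [mul_div_assoc', div_lt_iff₀ (by positivity)]; nlinarith⟩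
  obtain ⟨u, v, -, hv, hKu, h1v, huv⟩ := generalized_tube_lemma hK (isCompact_singleton (x := (1 : G)))
    (n := {q : G × G | ‖f (q.1 * q.2) - f q.1‖ < δ})
    (isOpen_lt (by fun_prop) continuous_const)
    (by rintro ⟨a, b⟩ ⟨ha, hb⟩
        obtain rfl : b = 1 := hb
        simpa using hδ)
  obtain ⟨V₀, -, hV₀, hV₀v⟩ := exists_isCompact_isOpen_subgroup_subset (hv.mem_nhds (h1v rfl))
  filter_upwards [Filter.Iic_mem_atBot (⟨V₀, hV₀⟩ : OpenSubgroup G)] with V hV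
  rw [dist_zero_right, map_sub]
  refine (hM3 V f δ hδ.le (fun x hx w hw => ?_) g hg).trans_lt hδε
  exact le_of_lt (huv (Set.mk_mem_prod (hKu hx) (hV₀v (hV hw))))

theorem exists_mean_of_isLocallyElliptic [T2Space G] [LocallyCompactSpace G]
    [TotallyDisconnectedSpace G] (hG : IsLocallyElliptic G) {k : ℕ}
    (hk : IsNFree (p ^ (k + 1)) G) :
    ∃ M : (G →ᵇ ℚ_[p]) →L[ℚ_[p]] ℚ_[p], IsLeftInvariantPadicMean M ∧ ‖M‖ ≤ (p : ℝ) ^ k := by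
  obtain ⟨S, hdir, hS, hun⟩ := hG
  have hmem : ∀ g : G, ∃ U ∈ S, g ∈ U := fun g => by
    have : g ∈ ⋃ U ∈ S, (U : Set G) := hun ▸ Set.mem_univ g
    simpa using this
  have key : ∀ K : S, ∃ M : (G →ᵇ ℚ_[p]) →L[ℚ_[p]] ℚ_[p], ‖M‖ ≤ (p : ℝ) ^ k ∧ M 1 = 1 ∧
      ∀ g ∈ K.1, ∀ f, M (leftTranslate g f) = M f := fun K =>
    exists_mean_of_isCompact (hS K K.2).1 (hS K K.2).2 fun V hV hVK =>
      padic_norm_inv_natCast_le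
        (hk K V (hS K K.2).2 hV hVK (relIndex_ne_zero_of_isCompact (hS K K.2).1 hV))
  choose M hM1 hM2 hM3 using key
  have : Nonempty S := let ⟨U, hU, _⟩ := hmem 1; ⟨⟨U, hU⟩⟩
  have : IsDirectedOrder S := ⟨fun a b => by
    obtain ⟨c, hc, hac, hbc⟩ := hdir a a.2 b b.2
    exact ⟨⟨c, hc⟩, hac, hbc⟩⟩
  obtain ⟨L, hL, hlim⟩ := exists_continuousLinearMap_of_tendsto (atTop : Filter S) M hM1
  refine ⟨L, ⟨hlim _ _ (by simp [hM2]), fun g f => ?_⟩, hL⟩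
  rw [← sub_eq_zero, ← map_sub]
  obtain ⟨K, hK, hgK⟩ := hmem g
  refine hlim _ _ (tendsto_const_nhds.congr' ?_)
  -- Once `K'` contains `g`, the defect vanishes exactly.
  filter_upwards [Filter.Ici_mem_atTop (⟨K, hK⟩ : S)] with K' hK'
  rw [map_sub, hM3 K' g (hK' hgK), sub_self]

end Average

/-! ### Amenability implies local ellipticity -/

/-- If a finitely generated group acts with infinite orbits, then the constant function `1` is a sum
of coboundaries of `p`-adic integer valued functions. -/
theorem exists_sum_coboundary_eq_one {G X : Type*} [Group G] [MulAction G X] (p : ℕ)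
    [Fact p.Prime] (A : Finset G)
    (hX : ∀ x : X, (MulAction.orbit (Subgroup.closure (A : Set G)) x).Infinite) :
    ∃ F : G → X → ℤ_[p], ∀ x, ∑ a ∈ A, (F a x - F a (a⁻¹ • x)) = 1 := by
  classical
  let Φ : (G → X → ℤ_[p]) →+ (X → ℤ_[p]) :=
    { toFun := fun F x => ∑ a ∈ A, (F a x - F a (a⁻¹ • x))
      map_zero' := by ext; simp
      map_add' := fun F F' => by
        funext x
        simp only [Pi.add_apply, ← Finset.sum_add_distrib]
        exact Finset.sum_congr rfl fun a _ => by ring }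
  have hΦ : ∀ F x, Φ F x = ∑ a ∈ A, (F a x - F a (a⁻¹ • x)) := fun _ _ => rfl
  have hcont : Continuous Φ := continuous_pi fun x => by
    simp only [hΦ]
    fun_prop
  -- `ℤ_[p]` is compact, hence so is the product: it suffices to approximate `1` pointwise.
  have hclosed : IsClosed (Set.range Φ) := (isCompact_range hcont).isClosed
  have hgen : ∀ a ∈ A, ∀ x : X,
      (Pi.single x 1 - Pi.single (a • x) 1 : X → ℤ_[p]) ∈ Φ.range := fun a ha x => by
    refine ⟨Pi.single a (Pi.single x 1), ?_⟩
    funext y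
    rw [hΦ, Finset.sum_eq_single_of_mem a ha fun b _ hb => by simp [hb]]
    simp [Pi.single_apply, inv_smul_eq_iff]
  have horb : ∀ g ∈ Subgroup.closure (A : Set G), ∀ x : X,
      (Pi.single x 1 - Pi.single (g • x) 1 : X → ℤ_[p]) ∈ Φ.range := fun g hg => by
    induction hg using Subgroup.closure_induction with
    | mem a ha => exact hgen a ha
    | one => intro x; simp
    | mul a b _ _ ha hb =>
      intro x
      have := add_mem (hb x) (ha (b • x))
      rwa [sub_add_sub_cancel, ← mul_smul] at this
    | inv a _ ha =>
      intro x
      have := neg_mem (ha (a⁻¹ • x))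
      rwa [neg_sub, smul_inv_smul] at this
  -- Each point mass in `B` is compensated at a point of its infinite orbit outside `B`.
  have hB : ∀ B : Finset X, ∃ u ∈ Φ.range, ∀ x ∈ B, u x = 1 := fun B => by
    have hout : ∀ x : X, ∃ y ∈ MulAction.orbit (Subgroup.closure (A : Set G)) x, y ∉ B :=
      fun x => by
        obtain ⟨y, hy, hyB⟩ := (hX x).exists_notMem_finset B
        exact ⟨y, hy, hyB⟩
    choose y hy hyB using hout
    refine ⟨∑ x ∈ B, (Pi.single x 1 - Pi.single (y x) 1), sum_mem fun x _ => ?_, fun x hx => ?_⟩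
    · obtain ⟨g, hg⟩ := hy x
      have := horb g g.2 x
      rwa [show (g : G) • x = y x from hg] at this
    · have hne : ∀ z, x ≠ y z := fun z h => hyB z (h ▸ hx)
      simp [Finset.sum_apply, Pi.single_apply, hne, hx]
  choose u hu hu1 using hB
  have hlim : Tendsto u atTop (𝓝 1) := tendsto_pi_nhds.2 fun x => by
    refine tendsto_const_nhds.congr' ?_
    filter_upwards [Filter.Ici_mem_atTop {x}] with B hB
    exact (hu1 B x (hB (Finset.mem_singleton_self x))).symm
  obtain ⟨F, hF⟩ := hclosed.mem_of_tendsto hlim (Eventually.of_forall hu)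
  exact ⟨F, fun x => congrFun hF x⟩

section

variable {G : Type*} [Group G] [TopologicalSpace G] [IsTopologicalGroup G]

theorem IsNormedPadicAmenable.exists_finite_orbit {p : ℕ} [Fact p.Prime]
    (hG : IsNormedPadicAmenable p G) {V : Subgroup G} (hV : IsOpen (V : Set G)) (A : Finset G) :
    ∃ x : G ⧸ V, (MulAction.orbit (Subgroup.closure (A : Set G)) x).Finite := by
  by_contra! hX
  obtain ⟨F, hF⟩ := exists_sum_coboundary_eq_one p A hX
  obtain ⟨m, hm⟩ := hG
  have : DiscreteTopology (G ⧸ V) := QuotientGroup.discreteTopology hV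
  let f : G → G →ᵇ ℚ_[p] := fun a =>
    BoundedContinuousFunction.ofNormedAddCommGroup (fun x : G => (F a (x : G ⧸ V) : ℚ_[p]))
      ((continuous_of_discreteTopology (f := fun q : G ⧸ V => (F a q : ℚ_[p]))).comp
        QuotientGroup.continuous_mk) 1 fun x => PadicInt.norm_le_one _
  have h1 : (1 : G →ᵇ ℚ_[p]) = ∑ a ∈ A, (f a - leftTranslate a (f a)) := by
    ext x
    have := congrArg (fun z : ℤ_[p] => (z : ℚ_[p])) (hF (x : G ⧸ V))
    simp only [PadicInt.coe_sum, PadicInt.coe_sub, PadicInt.coe_one] at this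
    rw [BoundedContinuousFunction.coe_sum, Finset.sum_apply]
    exact this.symm
  have h2 := hm.map_one
  rw [h1, map_sum] at h2
  simp [hm.map_leftTranslate] at h2

/-- A finite orbit of `x K` puts the group in a finite union of the compact sets `q K x⁻¹`. -/
theorem IsNormedPadicAmenable.exists_isCompact_superset_closure {p : ℕ} [Fact p.Prime]
    (hG : IsNormedPadicAmenable p G) {K : Subgroup G} (hK : IsCompact (K : Set G))
    (hKo : IsOpen (K : Set G)) (A : Finset G) :
    ∃ Q : Set G, IsCompact Q ∧ (Subgroup.closure (A : Set G) : Set G) ⊆ Q := by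
  obtain ⟨x, hx⟩ := hG.exists_finite_orbit hKo A
  obtain ⟨x, rfl⟩ := QuotientGroup.mk_surjective x
  set T := MulAction.orbit (Subgroup.closure (A : Set G)) (x : G ⧸ K)
  refine ⟨⋃ q ∈ T, (fun k => q.out * k * x⁻¹) '' K,
    hx.isCompact_biUnion fun q _ => hK.image (by fun_prop), fun g hg => ?_⟩
  refine Set.mem_biUnion (x := ((g * x : G) : G ⧸ K)) ⟨⟨g, hg⟩, rfl⟩ ?_
  refine ⟨(((g * x : G) : G ⧸ K).out)⁻¹ * (g * x), ?_, by group⟩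
  exact QuotientGroup.eq.1 (QuotientGroup.out_eq' _)

/-- A compactly generated open subgroup is the product of a finitely generated subgroup with any
compact open subgroup. -/
theorem exists_finset_closure_subset_mul {K : Subgroup G} (hKo : IsOpen (K : Set G)) {P : Set G}
    (hP : IsCompact P) (hinv : ∀ x ∈ P, x⁻¹ ∈ P) (hmul : ∀ k ∈ K, ∀ x ∈ P, k * x ∈ P) :
    ∃ A : Finset G, ∀ x ∈ Subgroup.closure P,
      ∃ γ ∈ Subgroup.closure (A : Set G), ∃ k ∈ K, x = γ * k := by
  obtain ⟨A, hAP, hPA⟩ : ∃ A : Finset G, (A : Set G) ⊆ P ∧ ∀ x ∈ P, ∃ a ∈ A, ∃ k ∈ K, x = a * k := by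
    classical
    obtain ⟨t, ht⟩ := hP.elim_nhds_subcover' (fun x _ => (fun y => x⁻¹ * y) ⁻¹' (K : Set G))
      fun x _ => (hKo.preimage (by fun_prop)).mem_nhds (by simp)
    refine ⟨t.image Subtype.val, by intro x; simp +contextual, fun x hx => ?_⟩
    obtain ⟨a, ha, hxa⟩ := Set.mem_iUnion₂.1 (ht hx)
    exact ⟨a, Finset.mem_image_of_mem _ ha, _, hxa, by group⟩
  have step : ∀ x ∈ P, ∀ z, (∀ k ∈ K, ∃ γ ∈ Subgroup.closure (A : Set G), ∃ k' ∈ K, k * z = γ * k') →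
      ∃ γ ∈ Subgroup.closure (A : Set G), ∃ k' ∈ K, x * z = γ * k' := fun x hx z hz => by
    obtain ⟨a, ha, k, hk, rfl⟩ := hPA x hx
    obtain ⟨γ, hγ, k', hk', h⟩ := hz k hk
    exact ⟨a * γ, mul_mem (Subgroup.subset_closure ha) hγ, k', hk', by
      rw [mul_assoc, h, mul_assoc]⟩
  -- Since `K * P ⊆ P ⊆ A * K`, elements of `K` can be moved to the right past each generator or its
  -- inverse.
  have hA : ∀ z ∈ Subgroup.closure (A : Set G), ∀ k ∈ K,
      ∃ γ ∈ Subgroup.closure (A : Set G), ∃ k' ∈ K, k * z = γ * k' := fun z hz => by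
    induction hz using Subgroup.closure_induction_left with
    | one => exact fun k hk => ⟨1, one_mem _, k, hk, by simp⟩
    | mul_left a ha y _ hy =>
      intro k hk
      simpa [mul_assoc] using step _ (hmul k hk a (hAP ha)) y hy
    | inv_mul_cancel a ha y _ hy =>
      intro k hk
      simpa [mul_assoc] using step _ (hmul k hk _ (hinv a (hAP ha))) y hy
  refine ⟨A, fun x hx => ?_⟩
  have hstep : ∀ x ∈ P, ∀ y, (∃ γ ∈ Subgroup.closure (A : Set G), ∃ k ∈ K, y = γ * k) →
      ∃ γ ∈ Subgroup.closure (A : Set G), ∃ k ∈ K, x * y = γ * k := by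
    rintro x hx _ ⟨γ, hγ, k, hk, rfl⟩
    obtain ⟨γ', hγ', k', hk', h⟩ := step x hx γ (hA γ hγ)
    exact ⟨γ', hγ', k' * k, mul_mem hk' hk, by rw [← mul_assoc, h, mul_assoc]⟩
  induction hx using Subgroup.closure_induction_left with
  | one => exact ⟨1, one_mem _, 1, one_mem _, by simp⟩
  | mul_left x hx y _ hy => exact hstep x hx y hy
  | inv_mul_cancel x hx y _ hy => exact hstep _ (hinv x hx) y hy

theorem IsNormedPadicAmenable.exists_isCompact_isOpen_subgroup {p : ℕ} [Fact p.Prime]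
    (hG : IsNormedPadicAmenable p G) {K : Subgroup G} (hK : IsCompact (K : Set G))
    (hKo : IsOpen (K : Set G)) {C : Set G} (hC : IsCompact C) :
    ∃ H : Subgroup G, IsCompact (H : Set G) ∧ IsOpen (H : Set G) ∧ K ≤ H ∧ C ⊆ H := by
  let D : Set G := insert 1 (C ∪ C⁻¹)
  have hD : IsCompact D := (hC.union hC.inv).insert 1
  have hDinv : ∀ x ∈ D, x⁻¹ ∈ D := by
    rintro x (rfl | hx | hx)
    · exact Or.inl inv_one
    · exact Or.inr (Or.inr (by simpa using hx))
    · exact Or.inr (Or.inl hx)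
  -- `K D K` with `D` symmetric is compact, symmetric and left `K`-stable; `1 ∈ D` gives `K ⊆ P`.
  let P : Set G := (fun q : G × G × G => q.1 * q.2.1 * q.2.2) '' ((K : Set G) ×ˢ D ×ˢ (K : Set G))
  have hP : IsCompact P := (hK.prod (hD.prod hK)).image (by fun_prop)
  have hPinv : ∀ x ∈ P, x⁻¹ ∈ P := by
    rintro _ ⟨⟨a, d, b⟩, ⟨ha, hd, hb⟩, rfl⟩
    exact ⟨⟨b⁻¹, d⁻¹, a⁻¹⟩, ⟨K.inv_mem hb, hDinv d hd, K.inv_mem ha⟩, by simp [mul_assoc]⟩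
  have hPmul : ∀ k ∈ K, ∀ x ∈ P, k * x ∈ P := by
    rintro k hk _ ⟨⟨a, d, b⟩, ⟨ha, hd, hb⟩, rfl⟩
    exact ⟨⟨k * a, d, b⟩, ⟨K.mul_mem hk ha, hd, hb⟩, by simp [mul_assoc]⟩
  have hKP : (K : Set G) ⊆ P := fun k hk => ⟨⟨k, 1, 1⟩, ⟨hk, Or.inl rfl, K.one_mem⟩, by simp⟩
  have hCP : C ⊆ P := fun c hc =>
    ⟨⟨1, c, 1⟩, ⟨K.one_mem, Or.inr (Or.inl hc), K.one_mem⟩, by simp⟩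
  have hKH : K ≤ Subgroup.closure P := fun k hk => Subgroup.subset_closure (hKP hk)
  have hHo : IsOpen (Subgroup.closure P : Set G) := Subgroup.isOpen_mono hKH hKo
  obtain ⟨A, hA⟩ := exists_finset_closure_subset_mul hKo hP hPinv hPmul
  obtain ⟨Q, hQ, hAQ⟩ := hG.exists_isCompact_superset_closure hK hKo A
  refine ⟨Subgroup.closure P, ?_, hHo, hKH, hCP.trans Subgroup.subset_closure⟩
  refine ((hQ.prod hK).image (f := fun q : G × G => q.1 * q.2) (by fun_prop)).of_isClosed_subset
    (Subgroup.isClosed_of_isOpen _ hHo) fun x hx => ?_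
  obtain ⟨γ, hγ, k, hk, rfl⟩ := hA x hx
  exact ⟨(γ, k), ⟨hAQ hγ, hk⟩, rfl⟩

theorem IsNormedPadicAmenable.isLocallyElliptic [T2Space G] [LocallyCompactSpace G]
    [TotallyDisconnectedSpace G] {p : ℕ} [Fact p.Prime] (hG : IsNormedPadicAmenable p G) :
    IsLocallyElliptic G := by
  refine ⟨{U | IsCompact (U : Set G) ∧ IsOpen (U : Set G)}, fun U hU V hV => ?_, fun U hU => hU,
    Set.eq_univ_of_forall fun g => ?_⟩
  · obtain ⟨H, h1, h2, h3, h4⟩ := hG.exists_isCompact_isOpen_subgroup hU.1 hU.2 hV.1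
    exact ⟨H, ⟨h1, h2⟩, h3, h4⟩
  · obtain ⟨K, hK, hKo, -⟩ := exists_isCompact_isOpen_subgroup_subset (G := G) Filter.univ_mem
    obtain ⟨H, h1, h2, -, h4⟩ :=
      hG.exists_isCompact_isOpen_subgroup hK hKo (isCompact_singleton (x := g))
    exact Set.mem_biUnion (x := H) ⟨h1, h2⟩ (h4 rfl)

/-! ### Lower bound for the norm of a mean -/

/-- An open subgroup admits a continuous equivariant retraction from the ambient group. -/
theorem exists_continuous_equivariant {U : Subgroup G} (hU : IsOpen (U : Set G)) :
    ∃ u : G → U, Continuous u ∧ ∀ (h : U) (x : G), u (h * x) = h * u x := by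
  -- A representative of `U x`; it is locally constant, so `x * (r x)⁻¹` is continuous.
  let r : G → G := fun x => (Quotient.mk (QuotientGroup.rightRel U) x).out
  have hr : ∀ x, x * (r x)⁻¹ ∈ U := fun x =>
    QuotientGroup.rightRel_apply.1 (Quotient.mk_out (s := QuotientGroup.rightRel U) x)
  have hreq : ∀ x y, y * x⁻¹ ∈ U → r x = r y := fun x y h =>
    congrArg Quotient.out (Quotient.sound (s := QuotientGroup.rightRel U)
      (QuotientGroup.rightRel_apply.2 h))
  refine ⟨fun x => ⟨x * (r x)⁻¹, hr x⟩, Continuous.subtype_mk ?_ _, fun h x => Subtype.ext ?_⟩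
  · refine continuous_iff_continuousAt.2 fun x => ?_
    have hx : (fun y => y * x⁻¹) ⁻¹' (U : Set G) ∈ 𝓝 x :=
      (hU.preimage (by fun_prop)).mem_nhds (by simp)
    refine ContinuousAt.congr (f := fun y => y * (r x)⁻¹) (by fun_prop) ?_
    filter_upwards [hx] with y hy
    rw [hreq x y hy]
  · have : r (h * x) = r x := (hreq _ _ (by simp)).symm
    simp [this, mul_assoc]

/-- The norm of an invariant mean is bounded below by the `p`-part of finite indices of open
subgroups. -/
theorem IsLeftInvariantPadicMean.pow_le_norm {p : ℕ} [Fact p.Prime]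
    {m : (G →ᵇ ℚ_[p]) →L[ℚ_[p]] ℚ_[p]} (hm : IsLeftInvariantPadicMean m) {U V : Subgroup G}
    (hU : IsOpen (U : Set G)) (hV : IsOpen (V : Set G)) (h0 : V.relIndex U ≠ 0)
    {k : ℕ} (hk : p ^ k ∣ V.relIndex U) : (p : ℝ) ^ k ≤ ‖m‖ := by
  classical
  obtain ⟨u, hu, huU⟩ := exists_continuous_equivariant hU
  let Q := U ⧸ V.subgroupOf U
  have : Finite Q := Nat.finite_of_card_ne_zero h0
  have := Fintype.ofFinite Q
  have : DiscreteTopology Q :=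
    QuotientGroup.discreteTopology (hV.preimage continuous_subtype_val)
  let f : Q → G →ᵇ ℚ_[p] := fun q =>
    BoundedContinuousFunction.ofNormedAddCommGroup
      (fun x : G => if (u x : Q) = q then 1 else 0)
      ((continuous_of_discreteTopology (f := fun q' : Q => if q' = q then (1 : ℚ_[p]) else 0)).comp
        (QuotientGroup.continuous_mk.comp hu)) 1 fun x => by split_ifs <;> simp
  have hf : ∀ q x, f q x = if (u x : Q) = q then 1 else 0 := fun _ _ => rfl
  have hnorm : ∀ q, ‖f q‖ ≤ 1 := fun q =>
    BoundedContinuousFunction.norm_ofNormedAddCommGroup_le _ zero_le_one _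
  have hsum : (1 : G →ᵇ ℚ_[p]) = ∑ q, f q := by
    ext x
    rw [BoundedContinuousFunction.coe_sum, Finset.sum_apply]
    rw [Finset.sum_eq_single_of_mem (u x : Q) (Finset.mem_univ _) fun q _ hq => by
      rw [hf, if_neg hq.symm], hf, if_pos rfl, BoundedContinuousFunction.coe_one, Pi.one_apply]
  have hsmul : ∀ (h : U) (q : Q), f (h • q) = leftTranslate (h : G) (f q) := fun h q => by
    ext x
    have : u ((h : G)⁻¹ * x) = h⁻¹ * u x := by simpa using huU h⁻¹ x
    rw [leftTranslate_apply, hf, hf, this]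
    refine if_congr ?_ rfl rfl
    rw [← inv_smul_eq_iff]
    rfl
  -- `U` acts transitively on `Q`, so invariance forces equal means.
  have hconst : ∀ q : Q, m (f q) = m (f ((1 : U) : Q)) := fun q => by
    obtain ⟨h, rfl⟩ := QuotientGroup.mk_surjective q
    have : ((h : U) : Q) = h • ((1 : U) : Q) :=
      congrArg (QuotientGroup.mk (s := V.subgroupOf U)) (mul_one h).symm
    rw [this, hsmul, hm.map_leftTranslate]
  have hcard : Fintype.card Q = V.relIndex U := by
    rw [Fintype.card_eq_nat_card]; rfl
  have h1 := hm.map_one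
  rw [hsum, map_sum, Finset.sum_congr rfl fun q _ => hconst q, Finset.sum_const, Finset.card_univ,
    hcard, nsmul_eq_mul] at h1
  calc (p : ℝ) ^ k ≤ ‖(V.relIndex U : ℚ_[p])⁻¹‖ := le_padic_norm_inv_natCast h0 hk
    _ = ‖m (f ((1 : U) : Q))‖ := by rw [inv_eq_of_mul_eq_one_right h1]
    _ ≤ ‖m‖ * ‖f ((1 : U) : Q)‖ := m.le_opNorm _
    _ ≤ ‖m‖ := mul_le_of_le_one_right (norm_nonneg _) (hnorm _)

theorem IsNormedPadicAmenable.isPowFree {p : ℕ} [Fact p.Prime] (hG : IsNormedPadicAmenable p G) :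
    IsPowFree p G := by
  obtain ⟨m, hm⟩ := hG
  have hp : (1 : ℝ) < p := by exact_mod_cast (Fact.out : p.Prime).one_lt
  obtain ⟨k, hk⟩ := pow_unbounded_of_one_lt ‖m‖ hp
  -- `p ^ k` already exceeds `‖m‖`; the extra `1` only ensures a positive exponent.
  refine ⟨k + 1, by omega, fun U V hU hV _ h0 hd => ?_⟩
  have := hm.pow_le_norm hU hV h0 ((pow_dvd_pow p k.le_succ).trans hd)
  exact absurd hk this.not_gt

end

/-! ### The equivalence and the norm formula -/

theorem mainTheorem1 (p : ℕ) [Fact p.Prime] (G : Type*) [Group G] [TopologicalSpace G]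
    [IsTopologicalGroup G] [T2Space G] [LocallyCompactSpace G] [TotallyDisconnectedSpace G] :
    (IsNormedPadicAmenable p G ↔ IsLocallyElliptic G ∧ IsPowFree p G) ∧
    (IsNormedPadicAmenable p G →
      ∃ N : ℕ, padicAmenabilityNorm p G = (N : ℝ≥0∞) ∧
        IsLeast {n : ℕ | ∃ k : ℕ, n = p ^ k ∧ IsNFree (p ^ (k + 1)) G} N ∧
        IsGreatest {n : ℕ | ∃ k : ℕ, n = p ^ k ∧
          ∃ U V : Subgroup G, IsOpen (U : Set G) ∧ IsOpen (V : Set G) ∧ V ≤ U ∧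
            V.relIndex U ≠ 0 ∧ p ^ k ∣ V.relIndex U} N) := by
  classical
  have hp : p.Prime := Fact.out
  refine ⟨⟨fun h => ⟨h.isLocallyElliptic, h.isPowFree⟩, ?_⟩, fun h => ?_⟩
  · rintro ⟨hell, k, hk, hfree⟩
    obtain ⟨k, rfl⟩ := Nat.exists_eq_add_of_le' hk
    obtain ⟨M, hM, -⟩ := exists_mean_of_isLocallyElliptic hell hfree
    exact ⟨M, hM⟩
  have hex : ∃ k, IsNFree (p ^ (k + 1)) G := by
    obtain ⟨k, hk, hfree⟩ := h.isPowFree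
    obtain ⟨k, rfl⟩ := Nat.exists_eq_add_of_le' hk
    exact ⟨k, hfree⟩
  let k := Nat.find hex
  have hk : IsNFree (p ^ (k + 1)) G := Nat.find_spec hex
  obtain ⟨U, V, hU, hV, hVU, h0, hd⟩ : ∃ U V : Subgroup G, IsOpen (U : Set G) ∧
      IsOpen (V : Set G) ∧ V ≤ U ∧ V.relIndex U ≠ 0 ∧ p ^ k ∣ V.relIndex U := by
    -- For `k = 0` the trivial index serves; otherwise minimality at `k - 1` says that `G` is not `p
    -- ^ k`-free.
    rcases Nat.eq_zero_or_pos k with h0 | hpos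
    · exact ⟨⊤, ⊤, isOpen_univ, isOpen_univ, le_rfl, by simp, by simp [h0]⟩
    · have := Nat.find_min hex (m := k - 1) (Nat.sub_lt hpos one_pos)
      rw [Nat.sub_add_cancel (show 1 ≤ k from hpos)] at this
      simpa [IsNFree] using this
  refine ⟨p ^ k, le_antisymm ?_ ?_, ⟨⟨k, rfl, hk⟩, ?_⟩, ⟨k, rfl, U, V, hU, hV, hVU, h0, hd⟩, ?_⟩
  · obtain ⟨M, hM, hMk⟩ := exists_mean_of_isLocallyElliptic h.isLocallyElliptic hk
    refine (iInf₂_le M hM).trans ?_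
    have : ‖M‖₊ ≤ ((p ^ k : ℕ) : NNReal) := by
      rw [← NNReal.coe_le_coe]
      simpa using hMk
    exact_mod_cast this
  · refine le_iInf₂ fun M hM => ?_
    have : ((p ^ k : ℕ) : NNReal) ≤ ‖M‖₊ := by
      rw [← NNReal.coe_le_coe]
      simpa using hM.pow_le_norm hU hV h0 hd
    exact_mod_cast this
  · rintro _ ⟨j, rfl, hj⟩
    exact Nat.pow_le_pow_right hp.pos (Nat.find_min' hex hj)
  · rintro _ ⟨j, rfl, U', V', hU', hV', hVU', h0', hd'⟩
    refine Nat.pow_le_pow_right hp.pos ?_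
    by_contra! hlt
    exact hk U' V' hU' hV' hVU' h0' ((pow_dvd_pow p hlt).trans hd')
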